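/- There is a picture language that is recognized by a top-down deterministic DAG automaton under an input-driven picture-to-DAG encoding, but neither by a two-dimensional online tessellation automaton nor by a sgraffito automaton. Precisely: A picture over a finite alphabet $\Sigma$ is an $m\times n$ array of symbols, with $m,n\ge 1$ or $m=n=0$. Let $L_{\mathrm{bal}}$ be the set of nonempty pictures over $\{a,b\}$ in which $a$ and $b$ occur equally often. *DAG automata.* In a DAG, each vertex carries a label and a string $\mathit{in}(v)$ (resp. $\mathit{out}(v)$) listing its incoming (resp. outgoing) edges without repetition; multiple edges are allowed. A DAG automaton is a triple $(Q,\Sigma,R)$ with a finite state set $Q$ and a finite set $R$ of rules, each of the form $\alpha\to_\sigma\beta$ ($\alpha,\beta\in Q^*$, $\sigma\in\Sigma$) or $\varnothing$. It accepts a nonempty DAG (connected or not) if there is a map $\rho$ from edges to states such that $\rho(\mathit{in}(v))\to_{\ell(v)}\rho(\mathit{out}(v))$ is in $R$ for every vertex $v$, where $\ell(v)$ is the label of $v$; it accepts the empty DAG iff $\varnothing\in R$. It is top-down deterministic if for all $\alpha$, $\sigma$ and $k$ there is at most one rule $\alpha\to_\sigma\beta$ in $R$ with $|\beta|=k$. *Input-driven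 encodings.* Let $r:\Sigma\to\mathbb N_0^2$ be a rank function. An input-driven encoding maps each picture $P$ to an arbitrary but fixed DAG whose vertices are the positions of $P$, labelled by their symbols, such that a vertex with label $\sigma$ has in-degree $r(\sigma)_1$ and out-degree $r(\sigma)_2$; it is undefined on $P$ if and only if there is no such DAG. Under such an encoding, a DAG automaton recognizes the set of those pictures whose encoding is defined and accepted. *Online tessellation automata.* A (nondeterministic) two-dimensional online tessellation automaton has a finite state set $Q$, an initial state $q_0$, a set $F\subseteq Q$ of final states and $\delta:Q\times Q\times\Sigma\to 2^Q$. It accepts an $m\times n$ picture $P$ if there are states $q_{i,j}$ with $q_{i,0}=q_{0,j}=q_0$ for all $i,j$, with $q_{i,j}\in\delta(q_{i-1,j},q_{i,j-1},P_{i,j})$ for $1\le i\le m$, $1\le j\le n$, and with $q_{m,n}\in F$. *Sgraffito automata.* A (nondeterministic) sgraffito automaton has a finite state set $Q$, an initial state $q_0$, final states $F\subseteq Q$, a finite working alphabet $\Gamma\supseteq\Sigma$, a weight function $\mu:\Gamma\to\mathbb N_0$ and a nondeterministic transition relation. Its one head starts in state $q_0$ at the top-left position of the picture, which is surrounded by the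 sentinels $\vdash,\dashv,\top,\bot$ on the left, right, top and bottom side and $\#$ in the corners (for the empty picture it starts on the bottom-right $\#$). Depending on state and scanned symbol, each step changes the state, rewrites the scanned symbol and moves the head by at most one position right, left, down or up. A scanned symbol from $\Gamma$ must be replaced by a symbol of $\Gamma$ of strictly smaller weight; a sentinel is left unchanged, and the head then moves back into the picture (on $\#$ it stays). There are no transitions from final states; a picture is accepted if some computation reaches a final state. **Theorem.** Let $r(a)=(0,1)$, $r(b)=(1,0)$, and let $A$ be the DAG automaton with the single state $p$ and exactly the rules $\lambda\to_a p$ and $p\to_b\lambda$, where $\lambda$ is the empty string. Then $A$ is top-down deterministic, input-driven encodings with ranks $r$ exist, and under every one of them $A$ recognizes $L_{\mathrm{bal}}$. No online tessellation automaton and no sgraffito automaton recognizes $L_{\mathrm{bal}}$. -/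

import Mathlib

/-! ### Pictures -/

/-- A picture over `α`: a rectangular array of symbols. The empty picture has dimensions `(0, 0)`;
there are no pictures with exactly one vanishing dimension. -/
structure Picture (α : Type) where
  rows : ℕ
  cols : ℕ
  dims : rows = 0 ↔ cols = 0
  entry : Fin rows → Fin cols → α

/-- The positions of a picture (numbered from `0`). -/
abbrev Picture.Pos {α : Type} (P : Picture α) : Type := Fin P.rows × Fin P.cols

/-- The symbols on the border of a boundary picture: left `⊢`, right `⊣`, top `⊤`, bottom `⊥`,
and `#` in the four corners. -/
inductive Sentinel where
  | left | right | top | bottom | corner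

/-- The boundary picture of `P`, on the positions `{0, …, rows + 1} × {0, …, cols + 1}`; the picture
itself occupies the rows `1, …, rows` and the columns `1, …, cols`. (Values at other pairs of
natural numbers are never used.) -/
def Picture.boundary {α : Type} (P : Picture α) (p : ℕ × ℕ) : α ⊕ Sentinel :=
  if h : (1 ≤ p.1 ∧ p.1 ≤ P.rows) ∧ (1 ≤ p.2 ∧ p.2 ≤ P.cols) then
    Sum.inl (P.entry ⟨p.1 - 1, by omega⟩ ⟨p.2 - 1, by omega⟩)
  else if 1 ≤ p.1 ∧ p.1 ≤ P.rows then
    Sum.inr (if p.2 = 0 then Sentinel.left else Sentinel.right)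
  else if 1 ≤ p.2 ∧ p.2 ≤ P.cols then
    Sum.inr (if p.1 = 0 then Sentinel.top else Sentinel.bottom)
  else Sum.inr Sentinel.corner

/-! ### Two-dimensional online tessellation automata -/

/-- A (nondeterministic) two-dimensional online tessellation automaton over `α`. -/
structure OnlineTessellation (α : Type) where
  Q : Type
  finite_Q : Finite Q
  q₀ : Q
  F : Set Q
  /-- upper state, left state, symbol -/
  δ : Q → Q → α → Set Q

/-- `ρ` is a run on `P`: `ρ i j` is the state at position `(i, j)` of the boundary picture
(only `i ≤ rows + 1`, `j ≤ cols + 1` matter). The first row and the first column of the boundary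
picture carry `q₀`; the picture position `(i + 1, j + 1)` holds the symbol `P.entry i j`. -/
def OnlineTessellation.IsRun {α : Type} (A : OnlineTessellation α) (P : Picture α)
    (ρ : ℕ → ℕ → A.Q) : Prop :=
  (∀ i ≤ P.rows + 1, ρ i 0 = A.q₀) ∧
  (∀ j ≤ P.cols + 1, ρ 0 j = A.q₀) ∧
  ∀ (i : Fin P.rows) (j : Fin P.cols),
    ρ (i + 1) (j + 1) ∈ A.δ (ρ i (j + 1)) (ρ (i + 1) j) (P.entry i j)

/-- The picture language recognized by an online tessellation automaton. -/
def OnlineTessellation.language {α : Type} (A : OnlineTessellation α) : Set (Picture α) :=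
  {P | ∃ ρ : ℕ → ℕ → A.Q, A.IsRun P ρ ∧ ρ P.rows P.cols ∈ A.F}

/-! ### Sgraffito automata -/

/-- Head movements: right, left, down, up, no movement. -/
inductive HeadMove where
  | R | L | D | U | Z

/-- The position after a head movement. (The truncation of subtraction is immaterial: a head on the
border always moves back into the picture or stays.) -/
def HeadMove.apply : HeadMove → ℕ × ℕ → ℕ × ℕ
  | .R, p => (p.1, p.2 + 1)
  | .L, p => (p.1, p.2 - 1)
  | .D, p => (p.1 + 1, p.2)
  | .U, p => (p.1 - 1, p.2)
  | .Z, p => p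

/-- The forced head movement on a sentinel. -/
def Sentinel.bounce : Sentinel → HeadMove
  | .left => .R
  | .right => .L
  | .top => .D
  | .bottom => .U
  | .corner => .Z

/-- A (nondeterministic) two-dimensional sgraffito automaton with input alphabet `α`: a bounded
two-dimensional one-head automaton that, in each step on a field of the picture, replaces the
scanned symbol by one of strictly smaller weight. -/
structure Sgraffito (α : Type) where
  Q : Type
  finite_Q : Finite Q
  /-- the working alphabet -/
  Γ : Type
  finite_Γ : Finite Γ
  /-- the input alphabet is part of the working alphabet -/
  input : α ↪ Γ
  q₀ : Q
  F : Set Q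
  δ : Q → Γ ⊕ Sentinel → Set (Q × (Γ ⊕ Sentinel) × HeadMove)
  /-- the weight function -/
  μ : Γ → ℕ
  /-- there are no transitions from final states -/
  halting : ∀ q ∈ F, ∀ x, δ q x = ∅
  /-- on a sentinel, the automaton leaves it unchanged and returns to the picture -/
  bounded : ∀ q s q' y d, (q', y, d) ∈ δ q (Sum.inr s) → y = Sum.inr s ∧ d = s.bounce
  /-- on the picture, it writes a working symbol of smaller weight -/
  weight_reducing : ∀ q g q' y d, (q', y, d) ∈ δ q (Sum.inl g) →
    ∃ g' : Γ, y = Sum.inl g' ∧ μ g' < μ g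

/-- A configuration: state, head position, tape contents. -/
structure Sgraffito.Config {α : Type} (A : Sgraffito α) where
  state : A.Q
  head : ℕ × ℕ
  tape : ℕ × ℕ → A.Γ ⊕ Sentinel

/-- The initial configuration on `P`: the tape holds the boundary picture, the head is at the
top-left position of `P` (and on the bottom-right `#` if `P` is empty). -/
def Sgraffito.init {α : Type} (A : Sgraffito α) (P : Picture α) : A.Config where
  state := A.q₀
  head := (1, 1)
  tape := fun p => (P.boundary p).map A.input id

/-- One computation step. -/
def Sgraffito.Step {α : Type} (A : Sgraffito α) (c c' : A.Config) : Prop :=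
  ∃ q' y d, (q', y, d) ∈ A.δ c.state (c.tape c.head) ∧
    c' = ⟨q', d.apply c.head, Function.update c.tape c.head y⟩

/-- The picture language recognized by a sgraffito automaton: the pictures on which some
computation reaches a final state. -/
def Sgraffito.language {α : Type} (A : Sgraffito α) : Set (Picture α) :=
  {P | ∃ c : A.Config, Relation.ReflTransGen A.Step (A.init P) c ∧ c.state ∈ A.F}

/-! ### DAGs and DAG automata -/

/-- A directed acyclic multigraph on the finite vertex set `V` with vertex labels in `α` and with
ordered incoming and outgoing edges at every vertex. -/
structure Dag (α V : Type) where
  finite_V : Finite V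
  E : Type
  finite_E : Finite E
  label : V → α
  src : E → V
  tar : E → V
  inc : V → List E
  out : V → List E
  mem_inc : ∀ v e, e ∈ inc v ↔ tar e = v
  mem_out : ∀ v e, e ∈ out v ↔ src e = v
  nodup_inc : ∀ v, (inc v).Nodup
  nodup_out : ∀ v, (out v).Nodup
  acyclic : ∀ v, ¬ Relation.TransGen (fun u w => ∃ e, src e = u ∧ tar e = w) v v

/-- A rule is `∅` or `head →_σ tail`. -/
inductive DagRule (α Q : Type) where
  | empty : DagRule α Q
  | rule (head : List Q) (σ : α) (tail : List Q) : DagRule α Q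

/-- A DAG automaton over `α`. -/
structure DagAutomaton (α : Type) where
  Q : Type
  finite_Q : Finite Q
  R : Set (DagRule α Q)
  finite_R : R.Finite

/-- A run assigns states to the edges so that every vertex complies with a rule. -/
def DagAutomaton.IsRun {α V : Type} (A : DagAutomaton α) (G : Dag α V) (ρ : G.E → A.Q) : Prop :=
  ∀ v : V, DagRule.rule ((G.inc v).map ρ) (G.label v) ((G.out v).map ρ) ∈ A.R

/-- `A` accepts a nonempty DAG if it has a run on it, and the empty DAG if `∅` is a rule. -/
def DagAutomaton.Accepts {α V : Type} (A : DagAutomaton α) (G : Dag α V) : Prop :=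
  (Nonempty V ∧ ∃ ρ : G.E → A.Q, A.IsRun G ρ) ∨ (IsEmpty V ∧ DagRule.empty ∈ A.R)

/-- Top-down determinism: head, vertex label and length of the tail determine the tail. -/
def DagAutomaton.TopDownDeterministic {α : Type} (A : DagAutomaton α) : Prop :=
  ∀ (σ : α) (h t t' : List A.Q), t.length = t'.length →
    DagRule.rule h σ t ∈ A.R → DagRule.rule h σ t' ∈ A.R → t = t'

/-! ### Input-driven picture-to-DAG encodings -/

/-- The picture DAG of `P` without edges. -/
abbrev Picture.edgelessDag {α : Type} (P : Picture α) : Dag α P.Pos where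
  finite_V := inferInstance
  E := Empty
  finite_E := inferInstance
  label := fun p => P.entry p.1 p.2
  src := Empty.elim
  tar := Empty.elim
  inc := fun _ => []
  out := fun _ => []
  mem_inc := fun _ e => e.elim
  mem_out := fun _ e => e.elim
  nodup_inc := fun _ => List.nodup_nil
  nodup_out := fun _ => List.nodup_nil
  acyclic := by
    intro v h
    cases h with
    | single h => exact h.choose.elim
    | tail _ h => exact h.choose.elim

/-- `G` arises from `G'` by adding edges as prescribed by the ranks `r`: each vertex `v` gets
`(r (label v)).1` new incoming and `(r (label v)).2` new outgoing edges, listed after the old ones.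
The new edges are otherwise arbitrary. (They are pairwise distinct, as `G` lists edges without
repetition.) -/
def IsInputDrivenExtension {α V : Type} (r : α → ℕ × ℕ) (G' G : Dag α V) : Prop :=
  G.label = G'.label ∧ ∃ f : G'.E ↪ G.E, ∀ v : V,
    (∃ new : List G.E, G.inc v = (G'.inc v).map f ++ new ∧ new.length = (r (G'.label v)).1) ∧
    (∃ new : List G.E, G.out v = (G'.out v).map f ++ new ∧ new.length = (r (G'.label v)).2)

/-- An input-driven picture-to-DAG encoding over the doubly ranked alphabet `(α, r)`: it maps each
picture to an arbitrary but fixed DAG with the prescribed in- and out-degrees, and is undefined on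
the pictures for which no such DAG exists. -/
structure InputDrivenEncoding (α : Type) (r : α → ℕ × ℕ) where
  toDag : (P : Picture α) → Option (Dag α P.Pos)
  isExtension : ∀ (P : Picture α) (G : Dag α P.Pos), toDag P = some G →
    IsInputDrivenExtension r P.edgelessDag G
  isSome_of_exists : ∀ P : Picture α,
    (∃ G : Dag α P.Pos, IsInputDrivenExtension r P.edgelessDag G) → (toDag P).isSome

/-- The picture language recognized by a DAG automaton under an input-driven encoding: the pictures
whose encoding is defined and accepted. -/
def DagAutomaton.pictureLanguage {α : Type} {r : α → ℕ × ℕ} (A : DagAutomaton α)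
    (enc : InputDrivenEncoding α r) : Set (Picture α) :=
  {P | ∃ G : Dag α P.Pos, enc.toDag P = some G ∧ A.Accepts G}

/-! ### The witness -/

/-- The alphabet `{a, b}`. -/
inductive Letter where
  | a | b
  deriving DecidableEq

/-- The number of positions of `P` that carry the symbol `s`. -/
def Picture.count {α : Type} [DecidableEq α] (P : Picture α) (s : α) : ℕ :=
  ∑ i : Fin P.rows, ∑ j : Fin P.cols, if P.entry i j = s then 1 else 0

/-- The nonempty pictures over `{a, b}` with equally many `a` and `b`. -/
def balancedPictures : Set (Picture Letter) :=
  {P | 0 < P.rows ∧ 0 < P.cols ∧ P.count Letter.a = P.count Letter.b}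

/-- The ranks `r(a) = (0, 1)` and `r(b) = (1, 0)`. -/
def letterRank : Letter → ℕ × ℕ
  | .a => (0, 1)
  | .b => (1, 0)

/-- The DAG automaton with the single state `p` (the element of `Unit`) and exactly the two rules
`λ →_a p` and `p →_b λ`. -/
abbrev pairingAutomaton : DagAutomaton Letter where
  Q := Unit
  finite_Q := inferInstance
  R := {DagRule.rule [] Letter.a [()], DagRule.rule [()] Letter.b []}
  finite_R := Set.toFinite _

/-! ### The pairing automaton -/

/-! With these ranks an edge must run from an `a` to a `b` and exhausts both, so an encoding exists
exactly when `a` and `b` are equinumerous: the ranks do the counting, and the automaton only has to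
reject the empty picture.

Both negative results already hold on one-row pictures, by cut and paste. `splitWord n hn k l` has
two halves, governed by `k` and `l` separately, and is balanced iff `k = l`. If what passes the
middle cut takes values in a finite set independent of `n`, two balanced words with `k ≠ l` share
this trace (`exists_ne_of_finite_traces`), and their accepting runs splice into one on an unbalanced
word. For tessellation automata the trace is the state at column `n`. For sgraffito automata it is
the crossing sequence: each crossing lowers the weight of one of the two fields at the cut, so its
length is bounded (`AcceptsVia.length_le_cutWeight`), and `exists_accepting_merge` does the
splicing. -/

theorem pairingAutomaton_topDownDeterministic : pairingAutomaton.TopDownDeterministic := by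
  intro σ h t t' _ h₁ h₂
  simp only [Set.mem_insert_iff, Set.mem_singleton_iff, DagRule.rule.injEq] at h₁ h₂
  rcases h₁ with ⟨rfl, rfl, rfl⟩ | ⟨rfl, rfl, rfl⟩ <;> simp_all

theorem nonempty_inputDrivenEncoding (α : Type) (r : α → ℕ × ℕ) :
    Nonempty (InputDrivenEncoding α r) := by
  classical
  refine ⟨⟨fun P => if h : ∃ G : Dag α P.Pos, IsInputDrivenExtension r P.edgelessDag G
    then some h.choose else none, fun P G h => ?_, fun P h => ?_⟩⟩
  · split_ifs at h with hex
    rw [← Option.some.inj h]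
    exact hex.choose_spec
  · simp [h]

theorem Picture.count_eq_card {α : Type} [DecidableEq α] (P : Picture α) (s : α) :
    P.count s = Nat.card {p : P.Pos // P.entry p.1 p.2 = s} := by
  rw [Nat.card_eq_fintype_card, Fintype.card_subtype, Finset.card_filter, Picture.count,
    Fintype.sum_prod_type]

/-- Over an edgeless DAG, an input-driven extension has exactly the prescribed degrees. -/
theorem isInputDrivenExtension_edgelessDag_iff {α : Type} {r : α → ℕ × ℕ} {P : Picture α}
    {G : Dag α P.Pos} :
    IsInputDrivenExtension r P.edgelessDag G ↔
      (∀ p, G.label p = P.entry p.1 p.2) ∧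
        ∀ p : P.Pos, (G.inc p).length = (r (P.entry p.1 p.2)).1 ∧
          (G.out p).length = (r (P.entry p.1 p.2)).2 := by
  constructor
  · rintro ⟨hl, f, hf⟩
    refine ⟨fun p => congrFun hl p, fun p => ?_⟩
    obtain ⟨⟨n₁, h₁, h₁'⟩, n₂, h₂, h₂'⟩ := hf p
    rw [h₁, h₂]
    exact ⟨by simpa using h₁', by simpa using h₂'⟩
  · rintro ⟨hl, h⟩
    exact ⟨funext hl, ⟨Empty.elim, fun e => e.elim⟩, fun p =>
      ⟨⟨G.inc p, by simp, (h p).1⟩, ⟨G.out p, by simp, (h p).2⟩⟩⟩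

/-- If every vertex with property `p` has exactly one edge in its list `L` and the others have none,
then there are as many edges as vertices with property `p`. -/
theorem card_eq_of_fiber_lists {E V : Type} (f : E → V) (L : V → List E)
    (hL : ∀ v e, e ∈ L v ↔ f e = v) (p : V → Prop)
    (h₁ : ∀ v, p v → (L v).length = 1) (h₀ : ∀ v, ¬ p v → (L v).length = 0) :
    Nat.card E = Nat.card {v // p v} := by
  have hp : ∀ e, p (f e) := by
    intro e
    by_contra h
    have := List.length_eq_zero_iff.1 (h₀ _ h)
    have he := (hL (f e) e).2 rfl
    simp [this] at he
  refine Nat.card_eq_of_bijective (fun e => (⟨f e, hp e⟩ : {v // p v})) ⟨fun e e' h => ?_, ?_⟩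
  · have h : f e = f e' := congrArg Subtype.val h
    obtain ⟨x, hx⟩ := List.length_eq_one_iff.1 (h₁ _ (hp e'))
    have he := (hL (f e') e).2 h
    have he' := (hL (f e') e').2 rfl
    simp only [hx, List.mem_singleton] at he he'
    rw [he, he']
  · rintro ⟨v, hv⟩
    obtain ⟨x, hx⟩ := List.length_eq_one_iff.1 (h₁ v hv)
    exact ⟨x, Subtype.ext ((hL v x).1 (by simp [hx]))⟩

/-- Both sides count the edges: by their sources, which are the `a`, and by their targets, which are
the `b`. -/
theorem count_eq_of_isInputDrivenExtension {P : Picture Letter} {G : Dag Letter P.Pos}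
    (h : IsInputDrivenExtension letterRank P.edgelessDag G) :
    P.count Letter.a = P.count Letter.b := by
  obtain ⟨-, h⟩ := isInputDrivenExtension_edgelessDag_iff.1 h
  rw [P.count_eq_card, P.count_eq_card]
  rw [← card_eq_of_fiber_lists G.src G.out G.mem_out (fun p => P.entry p.1 p.2 = Letter.a)
    (fun v hv => by rw [(h v).2, hv]; rfl) (fun v hv => by
      rw [(h v).2]
      cases hx : P.entry v.1 v.2 with
      | a => exact absurd hx hv
      | b => rfl),
    ← card_eq_of_fiber_lists G.tar G.inc G.mem_inc (fun p => P.entry p.1 p.2 = Letter.b)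
    (fun v hv => by rw [(h v).1, hv]; rfl) (fun v hv => by
      rw [(h v).1]
      cases hx : P.entry v.1 v.2 with
      | a => rfl
      | b => exact absurd hx hv)]

/-- A bijection `φ` from the `a` to the `b` serves as edge set, each edge being named by its source.
-/
theorem Picture.exists_pairing_dag {P : Picture Letter}
    (h : P.count Letter.a = P.count Letter.b) :
    ∃ G : Dag Letter P.Pos, IsInputDrivenExtension letterRank P.edgelessDag G := by
  classical
  rw [P.count_eq_card, P.count_eq_card] at h
  obtain ⟨φ⟩ := Finite.card_eq.1 h
  let G : Dag Letter P.Pos :=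
    { finite_V := inferInstance
      E := {p : P.Pos // P.entry p.1 p.2 = Letter.a}
      finite_E := inferInstance
      label := fun p => P.entry p.1 p.2
      src := Subtype.val
      tar := fun e => (φ e).1
      inc := fun v => if h : P.entry v.1 v.2 = Letter.b then [φ.symm ⟨v, h⟩] else []
      out := fun v => if h : P.entry v.1 v.2 = Letter.a then [⟨v, h⟩] else []
      mem_inc := by
        intro v e
        split_ifs with hv
        · rw [List.mem_singleton, Equiv.eq_symm_apply, Subtype.ext_iff]
        · simp only [List.not_mem_nil, false_iff]
          rintro rfl
          exact hv (φ e).2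
      mem_out := by
        intro v e
        split_ifs with hv
        · rw [List.mem_singleton, Subtype.ext_iff]
        · simp only [List.not_mem_nil, false_iff]
          rintro rfl
          exact hv e.2
      nodup_inc := by intro v; split_ifs <;> simp
      nodup_out := by intro v; split_ifs <;> simp
      acyclic := by
        intro v hv
        have key : ∀ u w : P.Pos, Relation.TransGen
            (fun u w => ∃ e : {p : P.Pos // P.entry p.1 p.2 = Letter.a},
              e.1 = u ∧ (φ e).1 = w) u w →
            P.entry u.1 u.2 = Letter.a ∧ P.entry w.1 w.2 = Letter.b := by
          intro u w huw
          induction huw with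
          | single h =>
            obtain ⟨e, rfl, rfl⟩ := h
            exact ⟨e.2, (φ e).2⟩
          | tail _ h ih =>
            obtain ⟨e, -, rfl⟩ := h
            exact ⟨ih.1, (φ e).2⟩
        obtain ⟨ha, hb⟩ := key v v hv
        rw [ha] at hb
        cases hb }
  refine ⟨G, isInputDrivenExtension_edgelessDag_iff.2 ⟨fun _ => rfl, fun p => ?_⟩⟩
  simp only [G]
  obtain hp | hp : P.entry p.1 p.2 = Letter.a ∨ P.entry p.1 p.2 = Letter.b := by
    cases P.entry p.1 p.2 <;> simp
  all_goals simp [hp, letterRank]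

theorem pairingAutomaton_pictureLanguage (enc : InputDrivenEncoding Letter letterRank) :
    pairingAutomaton.pictureLanguage enc = balancedPictures := by
  ext P
  constructor
  · rintro ⟨G, hG, hacc⟩
    rcases hacc with ⟨⟨i, j⟩, -⟩ | ⟨-, h⟩
    · exact ⟨i.pos, j.pos, count_eq_of_isInputDrivenExtension (enc.isExtension P G hG)⟩
    -- The empty picture does have an encoding, but `∅` is not a rule.
    · simp at h
  · rintro ⟨hr, hc, hcount⟩
    obtain ⟨G, hG⟩ := Option.isSome_iff_exists.1
      (enc.isSome_of_exists P (Picture.exists_pairing_dag hcount))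
    obtain ⟨hl, hd⟩ := isInputDrivenExtension_edgelessDag_iff.1 (enc.isExtension P G hG)
    -- With a single state, compliance with a rule depends only on label and degrees.
    refine ⟨G, hG, Or.inl ⟨⟨⟨0, hr⟩, ⟨0, hc⟩⟩, fun _ => (), fun p => ?_⟩⟩
    obtain ⟨h₁, h₂⟩ := hd p
    have hp := hl p
    rw [hp]
    simp only [List.map_const', h₁, h₂]
    cases P.entry p.1 p.2 <;> simp [letterRank]

/-! ### One-row pictures with two independent halves -/

/-- The one-row picture `a^k b^(n-k) a^(n-l) b^l`. -/
abbrev splitWord (n : ℕ) (hn : 0 < n) (k l : ℕ) : Picture Letter where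
  rows := 1
  cols := 2 * n
  dims := by omega
  entry := fun _ j => if j.1 < k ∨ (n ≤ j.1 ∧ j.1 + l < 2 * n) then Letter.a else Letter.b

theorem splitWord_mem_balancedPictures_iff {n : ℕ} (hn : 0 < n) {k l : ℕ} (hk : k ≤ n)
    (hl : l ≤ n) : splitWord n hn k l ∈ balancedPictures ↔ k = l := by
  have ha : (splitWord n hn k l).count Letter.a = k + (n - l) := by
    have h : (Finset.range (2 * n)).filter (fun j => j < k ∨ (n ≤ j ∧ j + l < 2 * n)) =
        Finset.range k ∪ Finset.Ico n (2 * n - l) := by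
      ext j
      simp only [Finset.mem_filter, Finset.mem_range, Finset.mem_union, Finset.mem_Ico]
      omega
    have hd : Disjoint (Finset.range k) (Finset.Ico n (2 * n - l)) := by
      rw [Finset.disjoint_left]
      intro j
      simp only [Finset.mem_range, Finset.mem_Ico]
      omega
    calc (splitWord n hn k l).count Letter.a
        = ∑ j : Fin (2 * n), if j.1 < k ∨ (n ≤ j.1 ∧ j.1 + l < 2 * n) then 1 else 0 := by
          simp only [Picture.count, Finset.univ_unique, Finset.sum_singleton]
          exact Finset.sum_congr rfl fun j _ => if_congr (by split_ifs with h <;> simp [h]) rfl rfl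
      _ = ∑ j ∈ Finset.range (2 * n), if j < k ∨ (n ≤ j ∧ j + l < 2 * n) then 1 else 0 :=
          Fin.sum_univ_eq_sum_range (fun j => if j < k ∨ (n ≤ j ∧ j + l < 2 * n) then 1 else 0) _
      _ = k + (n - l) := by
          rw [← Finset.card_filter, h, Finset.card_union_of_disjoint hd, Finset.card_range,
            Nat.card_Ico]
          omega
  have hab : (splitWord n hn k l).count Letter.a + (splitWord n hn k l).count Letter.b =
      2 * n := by
    simp only [Picture.count, ← Finset.sum_add_distrib]
    rw [Finset.sum_congr rfl (fun i _ => Finset.sum_congr rfl (fun j _ =>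
      show _ = 1 by split_ifs <;> simp_all))]
    simp
  constructor
  · rintro ⟨-, -, h⟩
    omega
  · intro h
    refine ⟨Nat.one_pos, show 0 < 2 * n by omega, ?_⟩
    omega

/-- A family of accepting data for the balanced split words, taking values in a finite set
independent of the length, assigns the same value to two different words. -/
theorem exists_ne_of_finite_traces {τ : Type} {s : Set τ} (hs : s.Finite)
    (T : ∀ n, 0 < n → ℕ → τ → Prop) (hT : ∀ n hn k, k ≤ n → ∃ t ∈ s, T n hn k t) :
    ∃ n, ∃ hn : 0 < n, ∃ k l t, k ≤ n ∧ l ≤ n ∧ k ≠ l ∧ T n hn k t ∧ T n hn l t := by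
  classical
  -- The `n + 1` values of `k` outnumber the traces; the summand `1` keeps `n` positive when `s` is
  -- empty.
  set n := hs.toFinset.card + 1 with hn
  have hpos : 0 < n := by omega
  have hT' : ∀ k, ∃ t, k ≤ n → t ∈ s ∧ T n hpos k t := by
    intro k
    by_cases hk : k ≤ n
    · obtain ⟨t, ht, h⟩ := hT n hpos k hk
      exact ⟨t, fun _ => ⟨ht, h⟩⟩
    · obtain ⟨t, -⟩ := hT n hpos 0 (Nat.zero_le _)
      exact ⟨t, fun h => absurd h hk⟩
  choose f hf using hT'
  have hle : ∀ k ∈ Finset.range (n + 1), k ≤ n := fun k hk => by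
    rw [Finset.mem_range] at hk
    omega
  obtain ⟨k, hk, l, hl, hne, heq⟩ := Finset.exists_ne_map_eq_of_card_lt_of_maps_to
    (s := Finset.range (n + 1)) (t := hs.toFinset) (f := f) (by rw [Finset.card_range]; omega)
    (fun k hk => by simpa using (hf k (hle k (by simpa using hk))).1)
  exact ⟨n, hpos, k, l, f k, hle k hk, hle l hl, hne, (hf k (hle k hk)).2,
    heq ▸ (hf l (hle l hl)).2⟩

/-! ### Online tessellation automata -/

/-- The row above carries only `q₀`, so the two halves communicate through the state at column `n`
alone. -/
theorem OnlineTessellation.splitWord_mem_language (A : OnlineTessellation Letter) {n : ℕ}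
    (hn : 0 < n) {k l : ℕ} (hk : k ≤ n) (hl : l ≤ n) {ρ ρ' : ℕ → ℕ → A.Q}
    (hρ : A.IsRun (splitWord n hn k k) ρ) (hρ' : A.IsRun (splitWord n hn l l) ρ')
    (hF : ρ' 1 (2 * n) ∈ A.F) (h : ρ 1 n = ρ' 1 n) :
    splitWord n hn k l ∈ A.language := by
  obtain ⟨h₁, h₂, h₃⟩ := hρ
  obtain ⟨h₁', h₂', h₃'⟩ := hρ'
  refine ⟨fun i j => if j ≤ n then ρ i j else ρ' i j, ⟨fun i hi => ?_, fun j hj => ?_, ?_⟩, ?_⟩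
  · simpa using h₁ i hi
  · by_cases hjn : j ≤ n
    · simpa [hjn] using h₂ j hj
    · simpa [hjn] using h₂' j hj
  · intro i j
    obtain ⟨i, hi⟩ := i
    obtain ⟨j, hj⟩ := j
    obtain rfl : i = 0 := Nat.lt_one_iff.1 hi
    have h₃ := h₃ ⟨0, hi⟩ ⟨j, hj⟩
    have h₃' := h₃' ⟨0, hi⟩ ⟨j, hj⟩
    change j < 2 * n at hj
    dsimp only at h₃ h₃' ⊢
    rcases lt_trichotomy j n with hjn | hjn | hjn
    · rw [if_pos (by omega : j + 1 ≤ n), if_pos (by omega : j + 1 ≤ n), if_pos (by omega : j ≤ n)]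
      convert h₃ using 2
      simp [show ¬ n ≤ j by omega]
    -- Only here does a cell of the right half read a state of `ρ`; `h` replaces it by that of `ρ'`.
    · subst hjn
      rw [if_neg (by omega : ¬ j + 1 ≤ j), if_neg (by omega : ¬ j + 1 ≤ j), if_pos le_rfl,
        zero_add, h]
      rw [zero_add] at h₃'
      convert h₃' using 2
      simp [show ¬ j < k by omega, show ¬ j < l by omega]
    · rw [if_neg (by omega : ¬ j + 1 ≤ n), if_neg (by omega : ¬ j + 1 ≤ n),
        if_neg (by omega : ¬ j ≤ n)]
      convert h₃' using 2
      simp [show ¬ j < k by omega, show ¬ j < l by omega]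
  · simpa [show ¬ 2 * n ≤ n by omega] using hF

theorem OnlineTessellation.language_ne_balancedPictures (A : OnlineTessellation Letter) :
    A.language ≠ balancedPictures := by
  intro hA
  have := A.finite_Q
  obtain ⟨n, hn, k, l, q, hk, hl, hne, ⟨ρ, hρ, -, hq⟩, ρ', hρ', hF, hq'⟩ :=
    exists_ne_of_finite_traces (Set.finite_univ (α := A.Q))
    (fun n hn k q => ∃ ρ : ℕ → ℕ → A.Q, A.IsRun (splitWord n hn k k) ρ ∧
      ρ 1 (2 * n) ∈ A.F ∧ ρ 1 n = q) (by
      intro n hn k hk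
      have hmem := (splitWord_mem_balancedPictures_iff hn hk hk).2 rfl
      rw [← hA] at hmem
      obtain ⟨ρ, hρ, hF⟩ := hmem
      exact ⟨ρ 1 n, Set.mem_univ _, ρ, hρ, hF, rfl⟩)
  have := A.splitWord_mem_language hn hk hl hρ hρ' hF (hq.trans hq'.symm)
  rw [hA] at this
  exact hne ((splitWord_mem_balancedPictures_iff hn hk hl).1 this)

/-! ### Sgraffito automata -/

namespace Sgraffito

variable {α : Type} (A : Sgraffito α)

/-- `A` can reach a final state from `c` in `N` steps such that the states right after the changes
of the side form the list `t`. -/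
inductive AcceptsVia (side : ℕ × ℕ → Bool) : ℕ → A.Config → List A.Q → Prop
  | final (c : A.Config) : c.state ∈ A.F → AcceptsVia side 0 c []
  | stay {N : ℕ} {c c' : A.Config} {t : List A.Q} : A.Step c c' →
      side c'.head = side c.head → AcceptsVia side N c' t → AcceptsVia side (N + 1) c t
  | cross {N : ℕ} {c c' : A.Config} {t : List A.Q} : A.Step c c' →
      side c'.head ≠ side c.head → AcceptsVia side N c' t →
      AcceptsVia side (N + 1) c (c'.state :: t)

variable {A}

theorem exists_acceptsVia (side : ℕ × ℕ → Bool) {c d : A.Config}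
    (h : Relation.ReflTransGen A.Step c d) (hd : d.state ∈ A.F) :
    ∃ N t, A.AcceptsVia side N c t := by
  induction h using Relation.ReflTransGen.head_induction_on with
  | refl => exact ⟨0, [], .final d hd⟩
  | head hs _ ih =>
    obtain ⟨N, t, ht⟩ := ih
    rename_i c c' _
    by_cases hc : side c'.head = side c.head
    · exact ⟨_, _, .stay hs hc ht⟩
    · exact ⟨_, _, .cross hs hc ht⟩

/-- The configuration with the state, the head and the side `b` of the tape of `c`, and with the
other side of the tape of `d`. -/
abbrev merge (side : ℕ × ℕ → Bool) (b : Bool) (c d : A.Config) : A.Config where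
  state := c.state
  head := c.head
  tape := fun p => if side p = b then c.tape p else d.tape p

theorem tape_eq_of_step {c c' : A.Config} (h : A.Step c c') {p : ℕ × ℕ} (hp : p ≠ c.head) :
    c'.tape p = c.tape p := by
  obtain ⟨q, y, m, -, rfl⟩ := h
  simp [Function.update_of_ne hp]

/-- A step reads and writes only the scanned field, which lies on the side taken from `c`. -/
theorem merge_step {side : ℕ × ℕ → Bool} {c c' d : A.Config} (h : A.Step c c') :
    A.Step (merge side (side c.head) c d) (merge side (side c.head) c' d) := by
  obtain ⟨q, y, m, hm, rfl⟩ := h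
  refine ⟨q, y, m, by simpa using hm, ?_⟩
  simp only [Config.mk.injEq, true_and]
  funext p
  by_cases hp : p = c.head
  · subst hp; simp
  · simp [Function.update_of_ne hp]

/-- The step alters `d` only on the side that the merged tape takes from `c`. -/
theorem merge_step_passive {side : ℕ × ℕ → Bool} {b : Bool} {c d d' : A.Config}
    (h : A.Step d d') (hd : side d.head = b) : merge side b c d' = merge side b c d := by
  simp only [Config.mk.injEq, true_and]
  funext p
  by_cases hp : side p = b
  · simp [hp]
  · simp only [hp, if_false]
    exact tape_eq_of_step h (fun h => hp (h ▸ hd))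

/-- Two accepting computations with the same crossing sequence can be spliced. -/
theorem exists_accepting_merge {side : ℕ × ℕ → Bool} {I : A.Config → Prop} {cut : Bool → ℕ × ℕ}
    (hI : ∀ c c', I c → A.Step c c' → I c')
    (hcut : ∀ c c', I c → A.Step c c' → side c'.head ≠ side c.head →
      c'.head = cut (side c'.head)) :
    ∀ (K N M : ℕ) (c d : A.Config) (t : List A.Q), N + M ≤ K → I c → I d →
      A.AcceptsVia side N c t → A.AcceptsVia side M d t → side c.head = side d.head →
      ∃ e, Relation.ReflTransGen A.Step (merge side (side c.head) c d) e ∧ e.state ∈ A.F := by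
  intro K
  -- The bound is on the total number of remaining steps, since the two computations swap roles at
  -- every crossing.
  induction K with
  | zero =>
    intro N M c d t hK _ _ hc _ _
    cases hc with
    | final _ h => exact ⟨_, .refl, h⟩
    | stay => omega
    | cross => omega
  | succ K ih =>
    intro N M c d t hK hIc hId hc hd hs
    cases hc with
    | final _ h => exact ⟨_, .refl, h⟩
    | stay hstep hside hc' =>
      obtain ⟨e, he, hF⟩ := ih _ M _ d t (by omega) (hI _ _ hIc hstep) hId hc' hd
        (hside.trans hs)
      rw [hside] at he
      exact ⟨e, .head (merge_step hstep) he, hF⟩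
    | @cross N c c' t hstep hside hc' =>
      -- The computation of `c` waits at its crossing while that of `d` advances invisibly to its
      -- own.
      generalize ht : c'.state :: t = t' at hd
      cases hd with
      | final => cases ht
      | @stay M d d' _ hstep' hside' hd' =>
        obtain ⟨e, he, hF⟩ := ih _ _ c d' _ (by omega) hIc (hI _ _ hId hstep')
          (.cross hstep hside hc') (ht ▸ hd') (hs.trans hside'.symm)
        rw [merge_step_passive hstep' hs.symm] at he
        exact ⟨e, he, hF⟩
      | @cross M d d' _ hstep' hside' hd' =>
        obtain ⟨hq, rfl⟩ := List.cons.inj ht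
        have hsc : side c'.head = !side c.head := Bool.eq_not.2 hside
        have hsd : side d'.head = !side c.head := hs ▸ Bool.eq_not.2 hside'
        have hhead : d'.head = c'.head := by
          rw [hcut _ _ hIc hstep hside, hcut _ _ hId hstep' hside', hsc, hsd]
        obtain ⟨e, he, hF⟩ := ih _ _ d' c' _ (by omega) (hI _ _ hId hstep') (hI _ _ hIc hstep)
          hd' hc' (hsd.trans hsc.symm)
        -- After both crossings states and heads agree, so the merged configuration may be read with
        -- `d'` as the active one, on the opposite side.
        have hmerge : merge side (side d'.head) d' c' = merge side (side c.head) c' d := by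
          rw [← merge_step_passive hstep' hs.symm]
          simp only [Config.mk.injEq]
          refine ⟨hq.symm, hhead, funext fun p => ?_⟩
          rw [hsd]
          cases side p <;> cases side c.head <;> simp
        rw [hmerge] at he
        exact ⟨e, .head (merge_step hstep) he, hF⟩

/-- The configurations that can occur on a picture with one row and `w` columns. -/
structure OneRow (w : ℕ) (c : A.Config) : Prop where
  cell : ∀ j, 1 ≤ j → j ≤ w → ∃ g, c.tape (1, j) = Sum.inl g
  left : c.tape (1, 0) = Sum.inr .left
  right : c.tape (1, w + 1) = Sum.inr .right
  top : ∀ j, 1 ≤ j → j ≤ w → c.tape (0, j) = Sum.inr .top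
  bottom : ∀ j, 1 ≤ j → j ≤ w → c.tape (2, j) = Sum.inr .bottom
  head : (∃ j, j ≤ w + 1 ∧ c.head = (1, j)) ∨
    ∃ j, 1 ≤ j ∧ j ≤ w ∧ (c.head = (0, j) ∨ c.head = (2, j))

/-- A step on a one-row picture either rewrites a field or bounces back from the border. -/
theorem OneRow.step_cases {w : ℕ} {c c' : A.Config} (hc : OneRow w c) (h : A.Step c c') :
    (∃ j g g' m, 1 ≤ j ∧ j ≤ w ∧ c.head = (1, j) ∧ c.tape (1, j) = Sum.inl g ∧
      A.μ g' < A.μ g ∧ c'.head = HeadMove.apply m (1, j) ∧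
      c'.tape = Function.update c.tape (1, j) (Sum.inl g')) ∨
    (c'.tape = c.tape ∧ ((c.head = (1, 0) ∧ c'.head = (1, 1)) ∨
      (c.head = (1, w + 1) ∧ c'.head = (1, w)) ∨
      ∃ j, 1 ≤ j ∧ j ≤ w ∧ (c.head = (0, j) ∨ c.head = (2, j)) ∧ c'.head = (1, j))) := by
  obtain ⟨q, y, m, hm, rfl⟩ := h
  have key : ∀ s, c.tape c.head = Sum.inr s →
      Function.update c.tape c.head y = c.tape ∧ m = s.bounce := by
    intro s hs
    rw [hs] at hm
    obtain ⟨rfl, rfl⟩ := A.bounded _ _ _ _ _ hm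
    exact ⟨by rw [← hs, Function.update_eq_self], rfl⟩
  rcases hc.head with ⟨j, hj, hh⟩ | ⟨j, hj₁, hj₂, hh⟩
  · rcases Nat.eq_zero_or_pos j with rfl | hj₁
    · obtain ⟨h₁, rfl⟩ := key .left (by rw [hh, hc.left])
      exact .inr ⟨h₁, .inl ⟨hh, by simp [hh, Sentinel.bounce, HeadMove.apply]⟩⟩
    · rcases Nat.lt_or_ge w j with hj₂ | hj₂
      · obtain rfl : j = w + 1 := by omega
        obtain ⟨h₁, rfl⟩ := key .right (by rw [hh, hc.right])
        exact .inr ⟨h₁, .inr (.inl ⟨hh, by simp [hh, Sentinel.bounce, HeadMove.apply]⟩)⟩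
      · obtain ⟨g, hg⟩ := hc.cell j hj₁ hj₂
        rw [hh, hg] at hm
        obtain ⟨g', rfl, hlt⟩ := A.weight_reducing _ _ _ _ _ hm
        exact .inl ⟨j, g, g', m, hj₁, hj₂, hh, hg, hlt, by rw [hh], by rw [hh]⟩
  · rcases hh with hh | hh
    · obtain ⟨h₁, rfl⟩ := key .top (by rw [hh, hc.top j hj₁ hj₂])
      exact .inr ⟨h₁, .inr (.inr ⟨j, hj₁, hj₂, .inl hh,
        by simp [hh, Sentinel.bounce, HeadMove.apply]⟩)⟩
    · obtain ⟨h₁, rfl⟩ := key .bottom (by rw [hh, hc.bottom j hj₁ hj₂])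
      exact .inr ⟨h₁, .inr (.inr ⟨j, hj₁, hj₂, .inr hh,
        by simp [hh, Sentinel.bounce, HeadMove.apply]⟩)⟩

/-- Fields stay fields, and the corners are never reached because the head leaves a border position
only into the picture. -/
theorem OneRow.step {w : ℕ} {c c' : A.Config} (hc : OneRow w c) (h : A.Step c c') :
    OneRow w c' := by
  rcases hc.step_cases h with ⟨j, g, g', m, hj₁, hj₂, -, -, -, hh, ht⟩ | ⟨ht, hh⟩
  · refine ⟨fun i hi₁ hi₂ => ?_, ?_, ?_, fun i hi₁ hi₂ => ?_, fun i hi₁ hi₂ => ?_, ?_⟩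
    · by_cases hij : i = j
      · exact ⟨g', by simp [ht, hij]⟩
      · obtain ⟨x, hx⟩ := hc.cell i hi₁ hi₂
        exact ⟨x, by rw [ht, Function.update_of_ne (by simp [hij]), hx]⟩
    · rw [ht, Function.update_of_ne (by rw [Ne, Prod.mk.injEq]; omega), hc.left]
    · rw [ht, Function.update_of_ne (by rw [Ne, Prod.mk.injEq]; omega), hc.right]
    · rw [ht, Function.update_of_ne (by simp), hc.top i hi₁ hi₂]
    · rw [ht, Function.update_of_ne (by simp), hc.bottom i hi₁ hi₂]
    · rw [hh]
      cases m with
      | R => exact .inl ⟨j + 1, by omega, rfl⟩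
      | L => exact .inl ⟨j - 1, by omega, rfl⟩
      | D => exact .inr ⟨j, hj₁, hj₂, .inr rfl⟩
      | U => exact .inr ⟨j, hj₁, hj₂, .inl rfl⟩
      | Z => exact .inl ⟨j, by omega, rfl⟩
  · refine ⟨by rw [ht]; exact hc.cell, by rw [ht]; exact hc.left, by rw [ht]; exact hc.right,
      by rw [ht]; exact hc.top, by rw [ht]; exact hc.bottom, .inl ?_⟩
    rcases hh with ⟨-, hh⟩ | ⟨-, hh⟩ | ⟨j, -, hj₂, -, hh⟩
    · exact ⟨1, by omega, hh⟩
    · exact ⟨w, by omega, hh⟩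
    · exact ⟨j, by omega, hh⟩

variable (A) in
/-- The weight of a tape symbol; sentinels have weight `0`. -/
def weight (x : A.Γ ⊕ Sentinel) : ℕ := Sum.elim A.μ (fun _ => 0) x

/-- The side of a position with respect to the cut behind column `n`. -/
abbrev cutSide (n : ℕ) (p : ℕ × ℕ) : Bool := decide (n < p.2)

/-- The position in the first row next to the cut, on the side `b`. -/
abbrev cutHead (n : ℕ) (b : Bool) : ℕ × ℕ := (1, if b then n + 1 else n)

/-- The total weight of the two fields at the cut behind column `n` of the first row. -/
abbrev cutWeight (n : ℕ) (c : A.Config) : ℕ :=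
  A.weight (c.tape (1, n)) + A.weight (c.tape (1, n + 1))

theorem OneRow.cutWeight_le {w n : ℕ} {c c' : A.Config} (hc : OneRow w c) (h : A.Step c c') :
    cutWeight n c' ≤ cutWeight n c := by
  rcases hc.step_cases h with ⟨j, g, g', m, -, -, -, hg, hlt, -, ht⟩ | ⟨ht, -⟩
  · have hle : ∀ i, A.weight (c'.tape (1, i)) ≤ A.weight (c.tape (1, i)) := by
      intro i
      by_cases hij : i = j
      · simpa [hij, hg, ht, weight] using hlt.le
      · rw [ht, Function.update_of_ne (by simp [hij])]
    exact Nat.add_le_add (hle _) (hle _)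
  · rw [cutWeight, ht]

/-- The cut has a picture field on either side, so bouncing off the border never crosses it. A
crossing is a horizontal move between columns `n` and `n + 1`, and it rewrites the field it leaves.
-/
theorem OneRow.crossing {w n : ℕ} (hn : 1 ≤ n) (hnw : n + 1 ≤ w) {c c' : A.Config}
    (hc : OneRow w c) (h : A.Step c c') (hside : cutSide n c'.head ≠ cutSide n c.head) :
    c'.head = cutHead n (cutSide n c'.head) ∧ cutWeight n c' < cutWeight n c := by
  rcases hc.step_cases h with ⟨j, g, g', m, hj₁, hj₂, hh, hg, hlt, hh', ht⟩ | ⟨ht, hh⟩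
  · have hj : (j = n ∧ c'.head = (1, n + 1)) ∨ (j = n + 1 ∧ c'.head = (1, n)) := by
      have hside : ¬ (n < c'.head.2 ↔ n < c.head.2) := fun h => hside (decide_eq_decide.2 h)
      rw [hh', hh] at hside
      rw [hh']
      cases m <;> simp only [HeadMove.apply, Prod.mk.injEq, true_and, iff_self,
        not_true_eq_false] at hside ⊢ <;> omega
    rcases hj with ⟨rfl, hj⟩ | ⟨rfl, hj⟩
    · refine ⟨by simp [hj], ?_⟩
      rw [cutWeight, cutWeight, ht, hg, Function.update_self, Function.update_of_ne (by simp)]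
      exact Nat.add_lt_add_right hlt _
    · refine ⟨by simp [hj], ?_⟩
      rw [cutWeight, cutWeight, ht, hg, Function.update_self, Function.update_of_ne (by simp)]
      exact Nat.add_lt_add_left hlt _
  · exfalso
    apply hside
    rcases hh with ⟨h₁, h₂⟩ | ⟨h₁, h₂⟩ | ⟨j, -, -, h₁ | h₁, h₂⟩ <;>
      rw [h₁, h₂] <;> simp only [cutSide, decide_eq_decide] <;> omega

theorem AcceptsVia.length_le_cutWeight {w n : ℕ} (hn : 1 ≤ n) (hnw : n + 1 ≤ w) {N : ℕ}
    {c : A.Config} {t : List A.Q} (h : A.AcceptsVia (cutSide n) N c t) (hc : OneRow w c) :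
    t.length ≤ cutWeight n c := by
  induction h with
  | final => exact Nat.zero_le _
  | stay hs _ _ ih => exact (ih (hc.step hs)).trans (hc.cutWeight_le hs)
  | cross hs hside _ ih =>
    exact (ih (hc.step hs)).trans_lt (hc.crossing hn hnw hs hside).2

theorem oneRow_init {A : Sgraffito Letter} {n : ℕ} (hn : 0 < n) (k l : ℕ) :
    OneRow (2 * n) (A.init (splitWord n hn k l)) := by
  refine ⟨fun j h₁ h₂ => ?_, ?_, ?_, fun j h₁ h₂ => ?_, fun j h₁ h₂ => ?_,
    .inl ⟨1, by omega, rfl⟩⟩ <;> simp [init, Picture.boundary, *]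

theorem merge_init {A : Sgraffito Letter} {n : ℕ} (hn : 0 < n) {k l : ℕ} (hk : k ≤ n)
    (hl : l ≤ n) : merge (cutSide n) false (A.init (splitWord n hn k k))
      (A.init (splitWord n hn l l)) = A.init (splitWord n hn k l) := by
  simp only [init, Config.mk.injEq, true_and]
  funext p
  rw [← apply_ite (Sum.map A.input id)]
  congr 1
  by_cases hp : n < p.2
  · have h₁ : ¬ p.2 - 1 < k := by omega
    have h₂ : ¬ p.2 - 1 < l := by omega
    simp [Picture.boundary, hp, h₁, h₂]
  · have h₁ : n ≤ p.2 - 1 → p.2 = 0 := by omega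
    by_cases h₂ : p.2 = 0
    · simp [Picture.boundary, h₂]
    · have h₃ : ¬ n ≤ p.2 - 1 := fun h => h₂ (h₁ h)
      simp [Picture.boundary, hp, h₃]

/-- What matters is that the bound does not involve `n`: every initial field holds one of the two
input letters. -/
theorem cutWeight_init_le {A : Sgraffito Letter} {n : ℕ} (hn : 0 < n) (k l : ℕ) :
    cutWeight n (A.init (splitWord n hn k l)) ≤
      2 * (A.μ (A.input .a) + A.μ (A.input .b)) := by
  have h : ∀ p, A.weight ((A.init (splitWord n hn k l)).tape p) ≤
      A.μ (A.input .a) + A.μ (A.input .b) := by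
    intro p
    simp only [init]
    rcases (splitWord n hn k l).boundary p with (_ | _) | _ <;> simp [weight]
  have := h (1, n)
  have := h (1, n + 1)
  simp only [cutWeight]
  omega

theorem language_ne_balancedPictures (A : Sgraffito Letter) : A.language ≠ balancedPictures := by
  intro hA
  have := A.finite_Q
  obtain ⟨n, hn, k, l, t, hk, hl, hne, ⟨N, hN⟩, M, hM⟩ :=
    exists_ne_of_finite_traces (List.finite_length_le A.Q
      (2 * (A.μ (A.input .a) + A.μ (A.input .b))))
    (fun n hn k t => ∃ N, A.AcceptsVia (cutSide n) N (A.init (splitWord n hn k k)) t) (by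
      intro n hn k hk
      have hmem := (splitWord_mem_balancedPictures_iff hn hk hk).2 rfl
      rw [← hA] at hmem
      obtain ⟨c, hc, hF⟩ := hmem
      obtain ⟨N, t, ht⟩ := exists_acceptsVia (cutSide n) hc hF
      exact ⟨t, (ht.length_le_cutWeight hn (by omega) (oneRow_init hn k k)).trans
        (cutWeight_init_le hn k k), N, ht⟩)
  obtain ⟨e, he, hF⟩ := exists_accepting_merge (cut := cutHead n)
    (fun _ _ hc h => OneRow.step hc h)
    (fun _ _ hc h hs => (OneRow.crossing hn (by omega : n + 1 ≤ 2 * n) hc h hs).1)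
    _ N M _ _ t le_rfl (oneRow_init hn k k) (oneRow_init hn l l) hN hM rfl
  -- The head starts in column `1 ≤ n`, so the word for `k` supplies the left half.
  have hside : cutSide n (A.init (splitWord n hn k k)).head = false :=
    decide_eq_false (Nat.not_lt.2 hn)
  rw [hside, merge_init hn hk hl] at he
  have hmem : splitWord n hn k l ∈ A.language := ⟨e, he, hF⟩
  rw [hA] at hmem
  exact hne ((splitWord_mem_balancedPictures_iff hn hk hl).1 hmem)

end Sgraffito

theorem mainTheorem4 :
    pairingAutomaton.TopDownDeterministic ∧
    Nonempty (InputDrivenEncoding Letter letterRank) ∧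
    (∀ enc : InputDrivenEncoding Letter letterRank,
      pairingAutomaton.pictureLanguage enc = balancedPictures) ∧
    (∀ A : OnlineTessellation Letter, A.language ≠ balancedPictures) ∧
    (∀ A : Sgraffito Letter, A.language ≠ balancedPictures) :=
  ⟨pairingAutomaton_topDownDeterministic, nonempty_inputDrivenEncoding _ _,
    pairingAutomaton_pictureLanguage, OnlineTessellation.language_ne_balancedPictures,
    Sgraffito.language_ne_balancedPictures⟩
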